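/- Let $G$ be a finite simple graph on $n$ vertices that contains no triangle. Then the number of cycles of length five in $G$ (that is, the number of subgraphs of $G$, not necessarily induced, that are isomorphic to $C_5$) is at most $\left(\frac{n}{5}\right)^5$. -/

import Mathlib

/-!
Erdős's pentagon bound is proved by a sum-of-squares (flag algebra) certificate.

For a triple `(a, b, c)` of vertices, every vertex `x` has an adjacency pattern
`(x ~ a, x ~ b, x ~ c)`.  Fix one or more weightings of the patterns for each isomorphism type of
the triple (no edge, one edge, a path).  The square of the total weight of all vertices is a double sum over `x` and `y`,
hence a sum of local contributions of the 5-tuples `(a, b, c, x, y)`.  A positive combination of ten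
such squares is collected in `kernel`, so `∑ kernel ≥ 0` (`sum_kernel_nonneg`).

For suitable weights, on each triangle-free graph on five labelled vertices, the kernel
summed over the ten ways to split off a pair `{x, y}`, plus `150000` times the number of Hamiltonian
cycles, is at most `5760` (`local_inequality`, a finite check).  Summed over all maps
`Fin 5 → V`, which may repeat vertices (so no error terms arise), this bounds the number `N` of
closed 5-walks by `12 * 150000 * N ≤ 5760 * n ^ 5`, that is, `N ≤ 10 * (n / 5) ^ 5`
(`card_closedWalks_le`).  Every copy of the 5-cycle is traversed by ten closed walks, one
for each symmetry of the pentagon (`ten_mul_copyCount_le`).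

All squares vanish on the balanced blow-up of the pentagon, which is the extremal graph: for each
triple in it, the weighted count of the patterns is zero.  This is what the weights are chosen to
satisfy.
-/

open Finset

namespace PentagonCount

/-! ### The sum-of-squares certificate -/

/-- Weight of the adjacency pattern of a vertex to an independent triple; it depends only on the
number of neighbours in the triple. -/
def emptyWeight : Bool → Bool → Bool → ℤ
  | false, false, false => 2
  | true, true, true => -3
  | true, true, false | true, false, true | false, true, true => 4
  | _, _, _ => -5

/-- Weight of the adjacency pattern `(a, b, c)` to a triple whose only edge joins the first two
vertices.  In a triangle-free graph `a` and `b` are not both true; the four values belong to the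
patterns with `(a || b, c)` equal to `00`, `01`, `10` and `11`. -/
def edgeWeight (w₀ w₁ w₂ w₃ : ℤ) (a b c : Bool) : ℤ :=
  bif a || b then bif c then w₃ else w₂ else bif c then w₁ else w₀

/-- Weight of the adjacency pattern `(a, b, c)` to a path with middle vertex the second one.
In a triangle-free graph a neighbour of the middle vertex has no other neighbour on the path; the
four values belong to no neighbour, one end, both ends, and the middle vertex. -/
def pathWeight (w₀ w₁ w₂ w₃ : ℤ) (a b c : Bool) : ℤ :=
  bif b then w₃ else bif a then bif c then w₂ else w₁ else bif c then w₁ else w₀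

/-- The difference of two adjacency indicators, a weight antisymmetric under swapping the two
vertices. -/
def diffWeight (a b : Bool) : ℤ :=
  bif a then bif b then 0 else 1 else bif b then -1 else 0

variable {α : Type*}

/-- Contribution of `x` and `y` to the square attached to an independent triple. -/
def emptyKernel (e : α → α → Bool) (a b c x y : α) : ℤ :=
  emptyWeight (e x a) (e x b) (e x c) * emptyWeight (e y a) (e y b) (e y c)

/-- Contribution of `x` and `y` to the five squares attached to a triple whose only edge is `ab`. -/
def edgeKernel (e : α → α → Bool) (a b c x y : α) : ℤ :=
  24 * (edgeWeight (-10) 20 (-1) 6 (e x a) (e x b) (e x c) *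
    edgeWeight (-10) 20 (-1) 6 (e y a) (e y b) (e y c)) +
  397 * (edgeWeight (-2) 0 3 (-2) (e x a) (e x b) (e x c) *
    edgeWeight (-2) 0 3 (-2) (e y a) (e y b) (e y c)) +
  99 * (edgeWeight (-2) 0 1 0 (e x a) (e x b) (e x c) *
    edgeWeight (-2) 0 1 0 (e y a) (e y b) (e y c)) +
  56 * (edgeWeight (-2) 0 0 1 (e x a) (e x b) (e x c) *
    edgeWeight (-2) 0 0 1 (e y a) (e y b) (e y c)) +
  18000 * ((bif e x c then diffWeight (e x a) (e x b) else 0) *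
    (bif e y c then diffWeight (e y a) (e y b) else 0))

/-- Contribution of `x` and `y` to the four squares attached to a path `a`, `b`, `c`. -/
def pathKernel (e : α → α → Bool) (a b c x y : α) : ℤ :=
  108 * (pathWeight (-2) 0 2 (-1) (e x a) (e x b) (e x c) *
    pathWeight (-2) 0 2 (-1) (e y a) (e y b) (e y c)) +
  372 * (pathWeight (-4) (-1) 2 0 (e x a) (e x b) (e x c) *
    pathWeight (-4) (-1) 2 0 (e y a) (e y b) (e y c)) +
  1428 * (pathWeight (-2) (-1) 0 1 (e x a) (e x b) (e x c) *
    pathWeight (-2) (-1) 0 1 (e y a) (e y b) (e y c)) +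
  15156 * (diffWeight (e x a) (e x c) * diffWeight (e y a) (e y c))

/-- The kernel of a triple listed in its standard order: the edge first, or the path from end to
end. -/
def orderedKernel (e : α → α → Bool) (a b c x y : α) : ℤ :=
  bif e a b then
    bif e b c then pathKernel e a b c x y
    else bif e c a then 0 else edgeKernel e a b c x y
  else 0

/-- The full kernel.  The three rotations of `(a, b, c)` bring each triple that spans an edge into
standard order, so the edge and path kernels need not be summed over all orders of the triple. -/
def kernel (e : α → α → Bool) (a b c x y : α) : ℤ :=
  (bif e a b || e b c || e c a then 0 else 144 * emptyKernel e a b c x y) +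
    (orderedKernel e a b c x y + orderedKernel e b c a x y + orderedKernel e c a b x y)

theorem sum_sum_mul_nonneg {ι : Type*} [Fintype ι] (f : ι → ℤ) :
    0 ≤ ∑ x, ∑ y, f x * f y := by
  rw [← sum_mul_sum]
  exact mul_self_nonneg _

theorem sum_sum_const_mul_nonneg {ι : Type*} [Fintype ι] (k : ℕ) (f : ι → ℤ) :
    0 ≤ ∑ x, ∑ y, k * (f x * f y) := by
  simp_rw [← mul_sum _ _ (k : ℤ)]
  exact mul_nonneg k.cast_nonneg (sum_sum_mul_nonneg f)

variable [Fintype α]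

theorem sum_emptyKernel_nonneg (e : α → α → Bool) (a b c : α) :
    0 ≤ ∑ x, ∑ y, emptyKernel e a b c x y :=
  sum_sum_mul_nonneg fun x ↦ emptyWeight (e x a) (e x b) (e x c)

theorem sum_edgeKernel_nonneg (e : α → α → Bool) (a b c : α) :
    0 ≤ ∑ x, ∑ y, edgeKernel e a b c x y := by
  have h := fun k w₀ w₁ w₂ w₃ ↦
    sum_sum_const_mul_nonneg k fun x ↦ edgeWeight w₀ w₁ w₂ w₃ (e x a) (e x b) (e x c)
  simp only [edgeKernel, sum_add_distrib]
  exact add_nonneg (add_nonneg (add_nonneg (add_nonneg (h 24 _ _ _ _) (h 397 _ _ _ _))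
    (h 99 _ _ _ _)) (h 56 _ _ _ _)) (sum_sum_const_mul_nonneg 18000 _)

theorem sum_pathKernel_nonneg (e : α → α → Bool) (a b c : α) :
    0 ≤ ∑ x, ∑ y, pathKernel e a b c x y := by
  have h := fun k w₀ w₁ w₂ w₃ ↦
    sum_sum_const_mul_nonneg k fun x ↦ pathWeight w₀ w₁ w₂ w₃ (e x a) (e x b) (e x c)
  simp only [pathKernel, sum_add_distrib]
  exact add_nonneg (add_nonneg (add_nonneg (h 108 _ _ _ _) (h 372 _ _ _ _)) (h 1428 _ _ _ _))
    (sum_sum_const_mul_nonneg 15156 fun x ↦ diffWeight (e x a) (e x c))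

theorem sum_orderedKernel_nonneg (e : α → α → Bool) (a b c : α) :
    0 ≤ ∑ x, ∑ y, orderedKernel e a b c x y := by
  unfold orderedKernel
  cases e a b <;> cases e b c <;> cases e c a <;>
    simp [sum_edgeKernel_nonneg, sum_pathKernel_nonneg]

theorem sum_kernel_nonneg (e : α → α → Bool) (a b c : α) :
    0 ≤ ∑ x, ∑ y, kernel e a b c x y := by
  simp only [kernel, sum_add_distrib]
  refine add_nonneg ?_ (add_nonneg (add_nonneg ?_ ?_) ?_)
  · cases e a b || e b c || e c a
    · simpa [← mul_sum] using sum_emptyKernel_nonneg e a b c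
    · simp
  all_goals exact sum_orderedKernel_nonneg e _ _ _

/-! ### The local inequality on five vertices -/

/-- Whether `(a, b, c, x, y)` is a closed walk. -/
def isClosedWalk (e : α → α → Bool) (a b c x y : α) : Bool :=
  e a b && e b c && e c x && e x y && e y a

/-- One permutation of the five indices for each way to split off the last two as an unordered
pair. -/
def splits : List (Fin 5 → Fin 5) :=
  [![0, 1, 2, 3, 4], ![0, 1, 3, 2, 4], ![0, 1, 4, 2, 3], ![0, 2, 3, 1, 4], ![0, 2, 4, 1, 3],
   ![0, 3, 4, 1, 2], ![1, 2, 3, 0, 4], ![1, 2, 4, 0, 3], ![1, 3, 4, 0, 2], ![2, 3, 4, 0, 1]]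

/-- One permutation of the five indices for each of the twelve Hamiltonian cycles of `K₅`. -/
def cyclicOrders : List (Fin 5 → Fin 5) :=
  [![0, 1, 2, 3, 4], ![0, 1, 2, 4, 3], ![0, 1, 3, 2, 4], ![0, 1, 3, 4, 2],
   ![0, 1, 4, 2, 3], ![0, 1, 4, 3, 2], ![0, 2, 1, 3, 4], ![0, 2, 1, 4, 3],
   ![0, 2, 3, 1, 4], ![0, 2, 4, 1, 3], ![0, 3, 1, 2, 4], ![0, 3, 2, 1, 4]]

/-- A function of five vertices as a function of 5-tuples. -/
def onTuple (f : α → α → α → α → α → ℤ) (v : Fin 5 → α) : ℤ := f (v 0) (v 1) (v 2) (v 3) (v 4)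

/-- The adjacency matrix of a graph on five vertices from its upper triangle. -/
def ofBits (p q r s t u w x y z : Bool) : Fin 5 → Fin 5 → Bool :=
  ![![false, p, q, r, s], ![p, false, t, u, w], ![q, t, false, x, y], ![r, u, x, false, z],
    ![s, w, y, z, false]]

/-- The indicator of a closed walk. -/
def walkIndicator (e : α → α → Bool) (a b c x y : α) : ℤ :=
  bif isClosedWalk e a b c x y then 1 else 0

/-- The sum that the local inequality bounds, for a graph on the five indices. -/
def localSum (e : Fin 5 → Fin 5 → Bool) : ℤ :=
  (splits.map (onTuple (kernel e))).sum +
    150000 * (cyclicOrders.map (onTuple (walkIndicator e))).sum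

/-- Whether the graph `ofBits p q r s t u w x y z` has a triangle. -/
def hasTriangle (p q r s t u w x y z : Bool) : Bool :=
  (p && t && q) || (p && u && r) || (p && w && s) || (q && x && r) || (q && y && s) ||
  (r && z && s) || (t && x && u) || (t && y && w) || (u && z && w) || (x && z && y)

theorem localSum_ofBits_le : ∀ p q r s t u w x y z : Bool,
    (hasTriangle p q r s t u w x y z ||
      decide (localSum (ofBits p q r s t u w x y z) ≤ 5760)) = true := by
  decide +kernel

/-- The entries of the adjacency matrix range over all triangle-free graphs on five labelled
vertices, including those that arise from tuples with repeated vertices, where the copies of a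
vertex are not adjacent and have the same neighbours. -/
theorem local_inequality (e : Fin 5 → Fin 5 → Bool) (symm : ∀ i j, e i j = e j i)
    (irrefl : ∀ i, e i i = false)
    (triangleFree : ∀ i j k, (e i j && e j k && e i k) = false) : localSum e ≤ 5760 := by
  have he : e = ofBits (e 0 1) (e 0 2) (e 0 3) (e 0 4) (e 1 2) (e 1 3) (e 1 4) (e 2 3) (e 2 4)
      (e 3 4) := by
    funext i j
    fin_cases i <;> fin_cases j <;> first | exact irrefl _ | rfl | exact symm _ _
  have h := localSum_ofBits_le (e 0 1) (e 0 2) (e 0 3) (e 0 4) (e 1 2) (e 1 3) (e 1 4) (e 2 3)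
    (e 2 4) (e 3 4)
  rw [← he] at h
  simpa [hasTriangle, triangleFree] using h

/-! ### Summation over all 5-tuples -/

/-- A 5-tuple as nested pairs. -/
def tupleEquiv : (Fin 5 → α) ≃ α × α × α × α × α where
  toFun v := (v 0, v 1, v 2, v 3, v 4)
  invFun t := ![t.1, t.2.1, t.2.2.1, t.2.2.2.1, t.2.2.2.2]
  left_inv v := by
    funext i
    fin_cases i <;> rfl
  right_inv _ := rfl

theorem sum_onTuple (f : α → α → α → α → α → ℤ) :
    ∑ v, onTuple f v = ∑ a, ∑ b, ∑ c, ∑ x, ∑ y, f a b c x y := by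
  rw [Fintype.sum_equiv tupleEquiv (onTuple f) (fun t ↦ f t.1 t.2.1 t.2.2.1 t.2.2.2.1 t.2.2.2.2)
    fun _ ↦ rfl]
  simp only [Fintype.sum_prod_type]

/-- Averaging over a list of permutations of the coordinates does not change a sum over all
tuples. -/
theorem sum_list_map_comp {ι : Type*} [Fintype ι] [DecidableEq ι] (L : List (ι → ι))
    (hL : ∀ p ∈ L, Function.Injective p) (g : (ι → α) → ℤ) :
    ∑ v : ι → α, (L.map fun p ↦ g (v ∘ p)).sum = L.length * ∑ v, g v := by
  induction L with
  | nil => simp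
  | cons p L ih =>
    have hp : ∑ v : ι → α, g (v ∘ p) = ∑ v, g v :=
      ((Equiv.ofBijective p (Finite.injective_iff_bijective.1 (hL p (by simp)))).symm.arrowCongr
        (Equiv.refl α)).sum_comp g
    simp only [List.map_cons, sum_add_distrib, List.sum_cons, List.length_cons, hp,
      ih fun q hq ↦ hL q (by simp [hq])]
    push_cast
    ring

variable {V : Type*} [Fintype V] (G : SimpleGraph V)

open Classical in
/-- The closed walks of length five in `G`, as 5-tuples of vertices. -/
noncomputable def closedWalks : Finset (Fin 5 → V) :=
  {v | ∀ i, G.Adj (v i) (v (i + 1))}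

/-- Each tuple is counted ten times through `splits` and twelve times through `cyclicOrders` when
the local inequality is summed over all tuples. -/
theorem card_closedWalks_le (hG : G.CliqueFree 3) :
    1800000 * (#(closedWalks G) : ℤ) ≤ 5760 * (Fintype.card V : ℤ) ^ 5 := by
  classical
  let e : V → V → Bool := fun a b ↦ decide (G.Adj a b)
  have hlocal (v : Fin 5 → V) : localSum (fun i j ↦ e (v i) (v j)) ≤ 5760 := by
    refine local_inequality _ (fun i j ↦ by simp [e, G.adj_comm]) (fun i ↦ by simp [e])
      fun i j k ↦ Bool.eq_false_iff.2 fun h ↦ ?_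
    simp only [e, Bool.and_eq_true, decide_eq_true_eq] at h
    exact hG {v i, v j, v k} (SimpleGraph.is3Clique_triple_iff.2 ⟨h.1.1, h.2, h.1.2⟩)
  have hcount : ∑ v, onTuple (walkIndicator e) v = #(closedWalks G) := by
    rw [closedWalks, card_filter, Nat.cast_sum]
    refine sum_congr rfl fun v _ ↦ ?_
    simp [onTuple, walkIndicator, isClosedWalk, e, Fin.forall_fin_succ, cond_eq_ite, and_assoc]
  have hkernel : 0 ≤ ∑ v, onTuple (kernel e) v := by
    rw [sum_onTuple]
    exact sum_nonneg fun a _ ↦ sum_nonneg fun b _ ↦ sum_nonneg fun c _ ↦ sum_kernel_nonneg e a b c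
  have hsum := sum_le_sum fun v (_ : v ∈ univ) ↦ hlocal v
  have hs := sum_list_map_comp splits (by decide +kernel) (onTuple (kernel e))
  have hc := sum_list_map_comp cyclicOrders (by decide +kernel) (onTuple (walkIndicator e))
  have hlocalSum (v : Fin 5 → V) : localSum (fun i j ↦ e (v i) (v j)) =
      (splits.map fun p ↦ onTuple (kernel e) (v ∘ p)).sum +
        150000 * (cyclicOrders.map fun p ↦ onTuple (walkIndicator e) (v ∘ p)).sum := rfl
  simp only [hlocalSum, sum_add_distrib, ← mul_sum, hs, hc, hcount] at hsum
  simp [splits, cyclicOrders] at hsum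
  linarith

/-! ### Closed walks around a pentagon -/

/-- The ten symmetries of the pentagon: rotations `i ↦ k + i` and reflections `i ↦ k - i`. -/
def symmetry (d : Bool × Fin 5) (i : Fin 5) : Fin 5 := bif d.1 then d.2 + i else d.2 - i

theorem symmetry_adj : ∀ d i j, (SimpleGraph.cycleGraph 5).Adj (symmetry d i) (symmetry d j) ↔
    (SimpleGraph.cycleGraph 5).Adj i j := by decide

theorem symmetry_bijective : ∀ d, Function.Bijective (symmetry d) := by decide

theorem symmetry_injective : Function.Injective symmetry := by decide

/-- Precomposing a parametrization of each pentagon with the ten symmetries gives distinct closed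
walks. -/
theorem ten_mul_copyCount_le :
    10 * G.copyCount (SimpleGraph.cycleGraph 5) ≤ #(closedWalks G) := by
  classical
  let C := {H : G.Subgraph // Nonempty (SimpleGraph.cycleGraph 5 ≃g H.coe)}
  let φ : ∀ H : C, SimpleGraph.cycleGraph 5 ≃g H.1.coe := fun H ↦ H.2.some
  let walk : C × (Bool × Fin 5) → Fin 5 → V := fun t i ↦ φ t.1 (symmetry t.2 i)
  have hverts (t : C × (Bool × Fin 5)) (u : V) : u ∈ t.1.1.verts ↔ ∃ i, walk t i = u := by
    constructor
    · intro hu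
      obtain ⟨i, hi⟩ := (φ t.1).surjective ⟨u, hu⟩
      obtain ⟨j, rfl⟩ := (symmetry_bijective t.2).2 i
      exact ⟨j, congrArg Subtype.val hi⟩
    · rintro ⟨i, rfl⟩
      exact Subtype.property _
  have hwalk (t : C × (Bool × Fin 5)) (i j : Fin 5) :
      t.1.1.Adj (walk t i) (walk t j) ↔ (SimpleGraph.cycleGraph 5).Adj i j := by
    rw [← symmetry_adj t.2 i j, ← (φ t.1).map_adj_iff]
    rfl
  have hadj (t : C × (Bool × Fin 5)) (u w : V) : t.1.1.Adj u w ↔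
      ∃ i j, (SimpleGraph.cycleGraph 5).Adj i j ∧ walk t i = u ∧ walk t j = w := by
    constructor
    · intro h
      obtain ⟨i, rfl⟩ := (hverts t u).1 (t.1.1.edge_vert h)
      obtain ⟨j, rfl⟩ := (hverts t w).1 (t.1.1.edge_vert h.symm)
      exact ⟨i, j, (hwalk t i j).1 h, rfl, rfl⟩
    · rintro ⟨i, j, h, rfl, rfl⟩
      exact (hwalk t i j).2 h
  have hinj : Function.Injective walk := by
    intro t t' h
    -- the walk determines the subgraph that it traverses
    have hsub : t.1 = t'.1 := by
      apply Subtype.ext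
      ext
      · rw [hverts t, hverts t', h]
      · rw [hadj t, hadj t', h]
    obtain ⟨H, d⟩ := t
    obtain ⟨H', d'⟩ := t'
    obtain rfl : H = H' := hsub
    have hd : d = d' := symmetry_injective <| funext fun i ↦
      (φ H).injective (Subtype.ext (congrFun h i))
    rw [hd]
  have hmem (t : C × (Bool × Fin 5)) : walk t ∈ closedWalks G := by
    simp only [closedWalks, mem_filter, mem_univ, true_and]
    have hsucc : ∀ i : Fin 5, (SimpleGraph.cycleGraph 5).Adj i (i + 1) := by decide
    exact fun i ↦ t.1.1.adj_sub ((hwalk t i (i + 1)).2 (hsucc i))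
  have hcard : Fintype.card (C × (Bool × Fin 5)) ≤ #(closedWalks G) := by
    rw [← card_univ]
    exact card_le_card_of_injOn walk (fun t _ ↦ hmem t) hinj.injOn
  have hC : G.copyCount (SimpleGraph.cycleGraph 5) = Fintype.card C := by
    rw [SimpleGraph.copyCount, Fintype.card_subtype]
  rw [hC, mul_comm]
  simpa using hcard

end PentagonCount

theorem theorem2 {V : Type*} [Fintype V] (G : SimpleGraph V) (hG : G.CliqueFree 3) :
    (G.copyCount (SimpleGraph.cycleGraph 5) : ℝ) ≤ ((Fintype.card V : ℝ) / 5) ^ 5 := by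
  have h₁ : (10 * G.copyCount (SimpleGraph.cycleGraph 5) : ℝ) ≤
      #(PentagonCount.closedWalks G) := by
    exact_mod_cast PentagonCount.ten_mul_copyCount_le G
  have h₂ : (1800000 * #(PentagonCount.closedWalks G) : ℝ) ≤ 5760 * (Fintype.card V : ℝ) ^ 5 := by
    exact_mod_cast PentagonCount.card_closedWalks_le G hG
  rw [div_pow]
  linarith
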